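/- Let $N=N(M)$ be positive integers, defined for $M\ge 1$, with $M\le N(M)$ for all sufficiently large $M$ and $M/N(M)\to 0$ as $M\to\infty$. For $M\le N$ let $U_{M,N}$ be the measure on $\mathbb{C}^M$ with density, with respect to Lebesgue measure, $$\frac{1}{C_{M,N}}\prod_{i=1}^M|\zeta_i|^{2(N-M)}\prod_{1\le i<j\le M}|\zeta_i-\zeta_j|^2\prod_{i=1}^M e^{-N|\zeta_i|^2},$$ where $C_{M,N}$ is the integral over $\mathbb{C}^M$ of the product without the factor $1/C_{M,N}$. Then $U_{M,N}$ is a probability measure, that is, $0<C_{M,N}<\infty$. Let $L_M=\frac1M\sum_{i=1}^M\delta_{\zeta_i}$ be the empirical measure, a random element of the space $\mathcal{M}_1(\mathbb{C})$ of Borel probability measures on $\mathbb{C}$ with the weak topology. For $\mu\in\mathcal{M}_1(\mathbb{C})$ put $$I_2^c(\mu)=\int_{\mathbb{C}}\bigl(|\zeta|^2-\log|\zeta|^2\bigr)\,d\mu(\zeta)-c_0^c\in[0,\infty],\qquad c_0^c=\inf_{\nu\in\mathcal{M}_1(\mathbb{C})}\int_{\mathbb{C}}\bigl(|\zeta|^2-\log|\zeta|^2\bigr)\,d\nu(\zeta),$$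 where the integrand has the value $+\infty$ at $\zeta=0$. Then $L_M$ under the law $U_{M,N(M)}$ satisfies the large deviation principle on $\mathcal{M}_1(\mathbb{C})$ with speed $N(M)\,M\to\infty$ and good rate function $I_2^c$. That is, $I_2^c$ is lower semicontinuous with compact sublevel sets $\{I_2^c\le c\}$, $0\le c<\infty$; for every open $O\subset\mathcal{M}_1(\mathbb{C})$, $$\liminf_{M\to\infty}\frac{1}{N(M)\,M}\log U_{M,N(M)}(L_M\in O)\ge-\inf_{\mu\in O}I_2^c(\mu);$$ and for every closed $F\subset\mathcal{M}_1(\mathbb{C})$, $$\limsup_{M\to\infty}\frac{1}{N(M)\,M}\log U_{M,N(M)}(L_M\in F)\le-\inf_{\mu\in F}I_2^c(\mu),$$ where $\log 0=-\infty$ and $\inf\emptyset=+\infty$. -/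

import Mathlib

open MeasureTheory Filter Topology
open scoped ENNReal NNReal

noncomputable section

namespace ConditionedGinibre

/-- Random variables `Y n` with values in a topological space `X`, defined on `(Ω n, P n)`, satisfy
a large deviation principle with speed `a n → ∞` and good rate function `I : X → [0, ∞]`. The
logarithm `ENNReal.log` takes values in `[-∞, ∞]`, with `log 0 = -∞`, and an infimum over the empty
set is `∞`. -/
structure SatisfiesLDP {X : Type*} [TopologicalSpace X] {Ω : ℕ → Type*}
    [∀ n, MeasurableSpace (Ω n)] (P : ∀ n, Measure (Ω n)) (Y : ∀ n, Ω n → X)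
    (a : ℕ → ℝ) (I : X → ℝ≥0∞) : Prop where
  speed_tendsto : Tendsto a atTop atTop
  lowerSemicontinuous : LowerSemicontinuous I
  isCompact_sublevel : ∀ c : ℝ≥0, IsCompact {x | I x ≤ (c : ℝ≥0∞)}
  lower_bound : ∀ O : Set X, IsOpen O →
    -((⨅ x ∈ O, I x : ℝ≥0∞) : EReal) ≤
      liminf (fun n => ENNReal.log (P n (Y n ⁻¹' O)) / ((a n : ℝ) : EReal)) atTop
  upper_bound : ∀ F : Set X, IsClosed F →
    limsup (fun n => ENNReal.log (P n (Y n ⁻¹' F)) / ((a n : ℝ) : EReal)) atTop ≤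
      -((⨅ x ∈ F, I x : ℝ≥0∞) : EReal)

/-- The unnormalised density
`∏ |ζ_i| ^ (2 (N - M)) * ∏_{i < j} |ζ_i - ζ_j| ^ 2 * ∏ exp (-N |ζ_i| ^ 2)` on `ℂ^M`
(meaningful for `M ≤ N`). -/
def weight (M N : ℕ) (ζ : Fin M → ℂ) : ℝ :=
  (∏ i, ‖ζ i‖ ^ (2 * (N - M))) * (∏ i, ∏ j ∈ Finset.Ioi i, ‖ζ i - ζ j‖ ^ 2) *
    ∏ i, Real.exp (-(N : ℝ) * ‖ζ i‖ ^ 2)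

/-- The normalising constant `C_{M,N}`: the Lebesgue integral of the weight over `ℂ^M`. -/
def normConst (M N : ℕ) : ℝ≥0∞ :=
  ∫⁻ ζ : Fin M → ℂ, ENNReal.ofReal (weight M N ζ)

/-- The law `U_{M,N}` on `ℂ^M` with density `weight / C_{M,N}` with respect to Lebesgue measure. -/
def law (M N : ℕ) : Measure (Fin M → ℂ) :=
  (volume : Measure (Fin M → ℂ)).withDensity
    (fun ζ => ENNReal.ofReal (weight M N ζ) / normConst M N)

theorem isProbabilityMeasure_average {M : ℕ} (hM : 0 < M) (ζ : Fin M → ℂ) :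
    IsProbabilityMeasure ((M : ℝ≥0∞)⁻¹ • ∑ i, Measure.dirac (ζ i)) := by
  constructor
  have h : (M : ℝ≥0∞) ≠ 0 := by exact_mod_cast hM.ne'
  simp [ENNReal.inv_mul_cancel h (ENNReal.natCast_ne_top M)]

/-- The empirical measure `L_M = M⁻¹ ∑ δ_{ζ_i}` as a probability measure on `ℂ`. For `M = 0`, where
it does not exist, the value is an arbitrary one; this does not affect limits as `M → ∞`. -/
def empiricalMeasure (M : ℕ) (ζ : Fin M → ℂ) : ProbabilityMeasure ℂ :=
  if hM : 0 < M then
    ⟨(M : ℝ≥0∞)⁻¹ • ∑ i, Measure.dirac (ζ i), isProbabilityMeasure_average hM ζ⟩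
  else
    ⟨Measure.dirac 0, inferInstance⟩

/-- The function `ζ ↦ |ζ|² - log |ζ|²`, with value `+∞` at `ζ = 0`. By `one_le_sub_log` nothing is
truncated by `ENNReal.ofReal`. -/
def potential (ζ : ℂ) : ℝ≥0∞ :=
  if ζ = 0 then ⊤ else ENNReal.ofReal (‖ζ‖ ^ 2 - Real.log (‖ζ‖ ^ 2))

theorem one_le_sub_log {ζ : ℂ} (hζ : ζ ≠ 0) : 1 ≤ ‖ζ‖ ^ 2 - Real.log (‖ζ‖ ^ 2) := by
  have h : 0 < ‖ζ‖ ^ 2 := by positivity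
  linarith [Real.log_le_sub_one_of_pos h]

/-- `∫ (|ζ|² - log |ζ|²) dμ(ζ)`, an element of `[0, ∞]`. -/
def energy (μ : ProbabilityMeasure ℂ) : ℝ≥0∞ :=
  ∫⁻ ζ, potential ζ ∂(μ : Measure ℂ)

/-- The infimum of the energy over all probability measures on `ℂ`. -/
def minEnergy : ℝ≥0∞ := ⨅ ν : ProbabilityMeasure ℂ, energy ν

theorem minEnergy_ne_top : minEnergy ≠ ⊤ := by
  have h : minEnergy ≤ energy ⟨Measure.dirac 1, inferInstance⟩ := iInf_le _ _
  refine ne_top_of_le_ne_top ?_ h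
  simp [energy, potential]

/-- The rate function `μ ↦ ∫ (|ζ|² - log |ζ|²) dμ(ζ) - c₀`. The subtraction is the true one, because
`c₀` is finite and is the infimum of the minuend. -/
def rateFunction (μ : ProbabilityMeasure ℂ) : ℝ≥0∞ := energy μ - minEnergy

end ConditionedGinibre

end

namespace ConditionedGinibre

/-! The speed `N * M` dominates `M ^ 2`. The interaction of the particles and the volume of
configuration space matter only at scale `exp (O(M ^ 2))`, so the weight is in effect `exp (-N * M *
energy L_M)`, and the rate is the energy minus its minimum.

Upper bound: each `‖ζ i - ζ j‖ ^ 2` is at most `exp (‖ζ i‖ ^ 2) * exp (‖ζ j‖ ^ 2)`. The Gaussian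
weight absorbs this and leaves the exponent `N - M` on the energy (`weight_le`,
`lintegral_weight_le`). The estimate is pointwise in the configuration, so no exponential tightness
is needed.

Lower bound: a measure of finite energy is approximated by one with compact support off the origin
(`exists_compactly_supported`), and that one by empirical measures through the law of large numbers
(`exists_near_configurations`). Sorting the sample by real part and shifting its points apart keeps
the interaction and the volume above `δ ^ (2 * M * M)` (`le_lintegral_weight`).

The same two estimates on the whole space control `normConst`, and the errors vanish because `M / N
→ 0` (`tendsto_exponent_div`). -/

/-! ### Pointwise upper bound for the weight -/

theorem norm_sub_sq_le_exp (a b : ℂ) :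
    ‖a - b‖ ^ 2 ≤ Real.exp (‖a‖ ^ 2) * Real.exp (‖b‖ ^ 2) := by
  have h1 : ‖a - b‖ ≤ ‖a‖ + ‖b‖ := norm_sub_le a b
  have h2 : ‖a - b‖ ^ 2 ≤ (‖a‖ + ‖b‖) ^ 2 := by gcongr
  have h3 : (‖a‖ + ‖b‖) ^ 2 ≤ (1 + ‖a‖ ^ 2) * (1 + ‖b‖ ^ 2) := by
    nlinarith [sq_nonneg (1 - ‖a‖ * ‖b‖)]
  have ha := Real.add_one_le_exp (‖a‖ ^ 2)
  have hb := Real.add_one_le_exp (‖b‖ ^ 2)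
  calc _ ≤ (1 + ‖a‖ ^ 2) * (1 + ‖b‖ ^ 2) := h2.trans h3
    _ ≤ _ := by gcongr <;> linarith

/-- Each index lies in `M - 1` pairs: `M - 1 - i` times as the smaller one, `i` times as the larger.
-/
theorem prod_Ioi_exp_mul_exp {M : ℕ} (g : Fin M → ℝ) :
    ∏ i, ∏ j ∈ Finset.Ioi i, Real.exp (g i) * Real.exp (g j) =
      ∏ i, Real.exp (((M : ℝ) - 1) * g i) := by
  simp_rw [← Real.exp_add, ← Real.exp_sum, Finset.sum_add_distrib]
  congr 1
  have h : ∑ i : Fin M, ∑ j ∈ Finset.Ioi i, g j = ∑ j : Fin M, ∑ _i ∈ Finset.Iio j, g j :=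
    Finset.sum_comm' (by simp)
  rw [h, ← Finset.sum_add_distrib]
  refine Finset.sum_congr rfl fun i _ => ?_
  have hi : (i : ℕ) + 1 ≤ M := i.2
  simp only [Finset.sum_const, Fin.card_Ioi, Fin.card_Iio, nsmul_eq_mul]
  have : ((M - 1 - i : ℕ) : ℝ) = M - 1 - i := by
    rw [Nat.sub_sub, Nat.cast_sub (by omega)]; push_cast; ring
  rw [this]; ring

theorem continuous_weight (M N : ℕ) : Continuous (weight M N) := by
  unfold weight; fun_prop

theorem weight_nonneg (M N : ℕ) (ζ : Fin M → ℂ) : 0 ≤ weight M N ζ := by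
  unfold weight; positivity

/-- Of the `N` Gaussian factors per particle, `M - 1` pay for the interaction, `N - M` combine with
the powers of `‖ζ i‖`, and one is kept for integrability. -/
theorem weight_le {M N : ℕ} (h : M ≤ N) (ζ : Fin M → ℂ) :
    weight M N ζ ≤ (∏ i, (‖ζ i‖ ^ 2 * Real.exp (-‖ζ i‖ ^ 2)) ^ (N - M)) *
      ∏ i, Real.exp (-‖ζ i‖ ^ 2) := by
  have h1 : ∏ i, ∏ j ∈ Finset.Ioi i, ‖ζ i - ζ j‖ ^ 2 ≤
      ∏ i, Real.exp (((M : ℝ) - 1) * ‖ζ i‖ ^ 2) := by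
    rw [← prod_Ioi_exp_mul_exp fun i => ‖ζ i‖ ^ 2]
    refine Finset.prod_le_prod (fun i _ => by positivity) fun i _ => ?_
    exact Finset.prod_le_prod (fun i _ => by positivity) fun j _ => norm_sub_sq_le_exp _ _
  unfold weight
  calc _ ≤ (∏ i, ‖ζ i‖ ^ (2 * (N - M))) * (∏ i, Real.exp (((M : ℝ) - 1) * ‖ζ i‖ ^ 2)) *
        ∏ i, Real.exp (-(N : ℝ) * ‖ζ i‖ ^ 2) := by gcongr
    _ = _ := by
      rw [← Finset.prod_mul_distrib, ← Finset.prod_mul_distrib, ← Finset.prod_mul_distrib]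
      refine Finset.prod_congr rfl fun i _ => ?_
      rw [mul_pow, pow_mul, mul_assoc, mul_assoc, ← Real.exp_nat_mul, ← Real.exp_add,
        ← Real.exp_add, Nat.cast_sub h]
      congr 2; ring

theorem integral_exp_neg_norm_sq : ∫ z : ℂ, Real.exp (-‖z‖ ^ 2) = Real.pi := by
  have := GaussianFourier.integral_rexp_neg_mul_sq_norm (V := ℂ) (b := 1) one_pos
  simpa using this

theorem lintegral_prod_exp_neg_norm_sq (M : ℕ) :
    ∫⁻ ζ : Fin M → ℂ, ENNReal.ofReal (∏ i, Real.exp (-‖ζ i‖ ^ 2)) =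
      ENNReal.ofReal (Real.pi ^ M) := by
  have hint : Integrable fun z : ℂ => Real.exp (-‖z‖ ^ 2) := by
    -- A non-integrable function would have integral `0` by convention, not `π`.
    by_contra h
    have := integral_undef h
    rw [integral_exp_neg_norm_sq] at this
    exact Real.pi_ne_zero this
  have h2 : Integrable fun ζ : Fin M → ℂ => ∏ i, Real.exp (-‖ζ i‖ ^ 2) :=
    Integrable.fintype_prod fun _ => hint
  rw [← ofReal_integral_eq_lintegral_ofReal h2 (ae_of_all _ fun ζ => by positivity)]
  have := integral_fintype_prod_volume_eq_pow (ι := Fin M) fun z : ℂ => Real.exp (-‖z‖ ^ 2)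
  rw [this, integral_exp_neg_norm_sq, Fintype.card_fin]

theorem mul_exp_neg_eq {z : ℂ} (hz : z ≠ 0) :
    ‖z‖ ^ 2 * Real.exp (-‖z‖ ^ 2) = Real.exp (-(‖z‖ ^ 2 - Real.log (‖z‖ ^ 2))) := by
  have h : 0 < ‖z‖ ^ 2 := by positivity
  rw [neg_sub, sub_eq_add_neg, Real.exp_add, Real.exp_log h]

theorem normConst_ne_top {M N : ℕ} (h : M ≤ N) : normConst M N ≠ ⊤ := by
  refine ne_top_of_le_ne_top ?_ (lintegral_mono (μ := volume)
    (g := fun ζ : Fin M → ℂ => ENNReal.ofReal (∏ i, Real.exp (-‖ζ i‖ ^ 2))) fun ζ => ?_)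
  · rw [lintegral_prod_exp_neg_norm_sq]; exact ENNReal.ofReal_ne_top
  · refine ENNReal.ofReal_le_ofReal ((weight_le h ζ).trans ?_)
    refine mul_le_of_le_one_left (by positivity) (Finset.prod_le_one (fun i _ => by positivity)
      fun i _ => pow_le_one₀ (by positivity) ?_)
    rw [Real.exp_neg, ← div_eq_mul_inv, div_le_one (Real.exp_pos _)]
    linarith [Real.add_one_le_exp (‖ζ i‖ ^ 2)]

theorem continuous_potential : Continuous potential := by
  have h0 : Tendsto (fun t : ℝ => t - Real.log t) (𝓝[>] 0) atTop := by
    have h1 : Tendsto (fun t : ℝ => t) (𝓝[>] 0) (𝓝 0) :=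
      tendsto_nhdsWithin_of_tendsto_nhds tendsto_id
    have h2 := tendsto_neg_atBot_atTop.comp Real.tendsto_log_nhdsGT_zero
    simpa [sub_eq_add_neg] using h1.add_atTop h2
  rw [continuous_iff_continuousAt]
  intro z
  by_cases hz : z = 0
  · subst hz
    rw [continuousAt_iff_punctured_nhds]
    have h3 : Tendsto (fun z : ℂ => ‖z‖ ^ 2) (𝓝[≠] 0) (𝓝[>] 0) := by
      refine tendsto_nhdsWithin_iff.2 ⟨tendsto_nhdsWithin_of_tendsto_nhds ?_, ?_⟩
      · have : Continuous fun z : ℂ => ‖z‖ ^ 2 := by fun_prop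
        simpa using this.tendsto 0
      · filter_upwards [self_mem_nhdsWithin] with z hz
        have hz : z ≠ 0 := hz
        exact Set.mem_Ioi.2 (by positivity)
    have h4 := ENNReal.tendsto_ofReal_atTop.comp (h0.comp h3)
    have h5 : potential 0 = ⊤ := by simp [potential]
    rw [h5]
    refine h4.congr' ?_
    filter_upwards [self_mem_nhdsWithin] with z hz
    have hz : z ≠ 0 := hz
    simp [potential, hz]
  · have h1 : ContinuousAt (fun z : ℂ => ENNReal.ofReal (‖z‖ ^ 2 - Real.log (‖z‖ ^ 2))) z := by
      refine ENNReal.continuous_ofReal.continuousAt.comp ?_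
      refine ContinuousAt.sub (by fun_prop) (ContinuousAt.log (by fun_prop) ?_)
      positivity
    refine h1.congr ?_
    filter_upwards [isOpen_ne.mem_nhds hz] with w hw
    have hw : w ≠ 0 := hw
    simp [potential, hw]

theorem coe_empiricalMeasure {M : ℕ} (hM : 0 < M) (ζ : Fin M → ℂ) :
    (empiricalMeasure M ζ : Measure ℂ) = (M : ℝ≥0∞)⁻¹ • ∑ i, Measure.dirac (ζ i) := by
  simp [empiricalMeasure, hM]

theorem lintegral_empiricalMeasure {M : ℕ} (hM : 0 < M) (ζ : Fin M → ℂ) {f : ℂ → ℝ≥0∞}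
    (hf : Measurable f) :
    ∫⁻ z, f z ∂(empiricalMeasure M ζ : Measure ℂ) = (M : ℝ≥0∞)⁻¹ * ∑ i, f (ζ i) := by
  simp [coe_empiricalMeasure hM, lintegral_dirac' _ hf]

theorem integral_empiricalMeasure {M : ℕ} (hM : 0 < M) (ζ : Fin M → ℂ) (f : ℂ → ℝ) :
    ∫ z, f z ∂(empiricalMeasure M ζ : Measure ℂ) = (M : ℝ)⁻¹ * ∑ i, f (ζ i) := by
  rw [coe_empiricalMeasure hM, integral_smul_measure, integral_finsetSum_measure]
  · simp
  · intro i _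
    exact integrable_dirac (by simp)

theorem energy_empiricalMeasure {M : ℕ} (hM : 0 < M) {ζ : Fin M → ℂ} (hζ : ∀ i, ζ i ≠ 0) :
    energy (empiricalMeasure M ζ) =
      ENNReal.ofReal ((M : ℝ)⁻¹ * ∑ i, (‖ζ i‖ ^ 2 - Real.log (‖ζ i‖ ^ 2))) := by
  have h0 : ∀ i, 0 ≤ ‖ζ i‖ ^ 2 - Real.log (‖ζ i‖ ^ 2) := fun i =>
    zero_le_one.trans (one_le_sub_log (hζ i))
  rw [energy, lintegral_empiricalMeasure hM _ continuous_potential.measurable,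
    ENNReal.ofReal_mul (by positivity), ENNReal.ofReal_sum_of_nonneg fun i _ => h0 i,
    ENNReal.ofReal_inv_of_pos (by positivity), ENNReal.ofReal_natCast]
  simp [potential, hζ]

/-- Upper bound for the unnormalised mass of a set of configurations whose empirical measures have
energy at least `c`. -/
theorem lintegral_weight_le {M N : ℕ} (hM : 0 < M) (h : M < N) {c : ℝ} (S : Set (Fin M → ℂ))
    (hS : ∀ ζ ∈ S, ENNReal.ofReal c ≤ energy (empiricalMeasure M ζ)) :
    ∫⁻ ζ in S, ENNReal.ofReal (weight M N ζ) ≤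
      ENNReal.ofReal (Real.exp (-(((N : ℝ) - M) * (M * c))) * Real.pi ^ M) := by
  have hM' : (0 : ℝ) < M := by exact_mod_cast hM
  have key : ∀ ζ ∈ S, weight M N ζ ≤
      Real.exp (-(((N : ℝ) - M) * (M * c))) * ∏ i, Real.exp (-‖ζ i‖ ^ 2) := by
    intro ζ hζ
    refine (weight_le h.le ζ).trans ?_
    gcongr
    by_cases h0 : ∀ i, ζ i ≠ 0
    · simp_rw [fun i => mul_exp_neg_eq (h0 i), ← Real.exp_nat_mul, ← Real.exp_sum, mul_neg,
        Finset.sum_neg_distrib, ← Finset.mul_sum, Nat.cast_sub h.le]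
      have h1 := hS ζ hζ
      rw [energy_empiricalMeasure hM h0, ENNReal.ofReal_le_ofReal_iff, inv_mul_eq_div,
        le_div_iff₀ hM'] at h1
      · have : (0 : ℝ) ≤ N - M := by
          rw [sub_nonneg]; exact_mod_cast h.le
        gcongr
        linarith
      · exact mul_nonneg (by positivity) (Finset.sum_nonneg fun i _ =>
          zero_le_one.trans (one_le_sub_log (h0 i)))
    -- With a particle at the origin the product contains `0 ^ (N - M)`, which vanishes because `M <
    -- N`.
    · push Not at h0
      obtain ⟨i, hi⟩ := h0
      rw [Finset.prod_eq_zero (Finset.mem_univ i)]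
      · positivity
      · rw [hi]; simp; omega
  calc _ ≤ ∫⁻ ζ in S, ENNReal.ofReal (Real.exp (-(((N : ℝ) - M) * (M * c))) *
        ∏ i, Real.exp (-‖ζ i‖ ^ 2)) := by
        refine setLIntegral_mono ?_ fun ζ hζ => ENNReal.ofReal_le_ofReal (key ζ hζ)
        fun_prop
    _ ≤ ∫⁻ ζ : Fin M → ℂ, ENNReal.ofReal (Real.exp (-(((N : ℝ) - M) * (M * c))) *
        ∏ i, Real.exp (-‖ζ i‖ ^ 2)) := setLIntegral_le_lintegral _ _
    _ = _ := by
        simp_rw [ENNReal.ofReal_mul (Real.exp_pos _).le]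
        rw [lintegral_const_mul _ (by fun_prop), lintegral_prod_exp_neg_norm_sq]

/-! ### Lower bounds for interaction, volume and confinement -/

theorem exp_neg_le_factorial_div_pow (M : ℕ) :
    Real.exp (-1) ^ M ≤ ∏ d ∈ Finset.range M, ((d : ℝ) + 1) / M := by
  rcases M.eq_zero_or_pos with rfl | hM
  · simp
  have hM' : (0 : ℝ) < M := by exact_mod_cast hM
  have h1 := Real.pow_div_factorial_le_exp M hM'.le M
  have h2 : ∏ d ∈ Finset.range M, ((d : ℝ) + 1) = (M.factorial : ℝ) := by
    rw [← Finset.prod_range_add_one_eq_factorial]; push_cast; rfl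
  rw [Finset.prod_div_distrib, h2, ← Real.exp_nat_mul, Finset.prod_const, Finset.card_range,
    mul_neg_one, Real.exp_neg, inv_le_comm₀ (Real.exp_pos _) (by positivity), inv_div]
  exact h1

/-- The differences `j - i` are distinct elements of `{1, …, M}`, and the factors missing from the
full product are at most `1`; what remains is `M! / M ^ M ≥ exp (-M)`. -/
theorem pow_le_prod_Ioi {M : ℕ} {η : ℝ} (h0 : 0 < η) (h1 : η ≤ 1) (i : Fin M) :
    (η * Real.exp (-1)) ^ M ≤
      ∏ j ∈ Finset.Ioi i, η * (((j : ℕ) : ℝ) - ((i : ℕ) : ℝ)) / M := by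
  have hM : 0 < M := i.pos
  have hM' : (0 : ℝ) < M := by exact_mod_cast hM
  calc (η * Real.exp (-1)) ^ M ≤ η ^ M * ∏ d ∈ Finset.range M, ((d : ℝ) + 1) / M := by
        rw [mul_pow]; gcongr; exact exp_neg_le_factorial_div_pow M
    _ = ∏ d ∈ Finset.range M, η * ((d : ℝ) + 1) / M := by
        simp_rw [mul_div_assoc, Finset.prod_mul_distrib, Finset.prod_const, Finset.card_range]
    _ ≤ ∏ d ∈ (Finset.Ioi i).image fun j : Fin M => (j : ℕ) - i - 1, η * ((d : ℝ) + 1) / M := by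
        refine Finset.prod_le_prod_of_subset_of_le_one ?_ (fun _ _ => by positivity) ?_
        · intro d hd
          obtain ⟨j, -, rfl⟩ := Finset.mem_image.1 hd
          exact Finset.mem_range.2 (by omega)
        · intro d hd _
          have : (d : ℝ) + 1 ≤ M := by exact_mod_cast Finset.mem_range.1 hd
          rw [div_le_one hM']
          nlinarith
    _ = _ := by
        rw [Finset.prod_image]
        · refine Finset.prod_congr rfl fun j hj => ?_
          have hj : (i : ℕ) < j := by simpa using hj
          rw [Nat.sub_sub, Nat.cast_sub (by omega)]
          push_cast; ring
        · intro j hj k hk hjk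
          have hj : (i : ℕ) < j := by simpa using hj
          have hk : (i : ℕ) < k := by simpa using hk
          exact Fin.ext (by simp only at hjk; omega)

/-- Since the real parts of `x` increase, the shifts `η * i / M` separate the points even where `x`
repeats itself. -/
theorem pow_le_prod_norm_sub {M : ℕ} {η : ℝ} (h0 : 0 < η) (h1 : η ≤ 1) {x ζ : Fin M → ℂ}
    (hx : Monotone fun i => (x i).re)
    (hζ : ∀ i, ‖ζ i - (x i + (η * ((i : ℕ) : ℝ) / M : ℝ))‖ < η / (4 * M)) :
    (η / 2 * Real.exp (-1)) ^ (2 * M * M) ≤ ∏ i, ∏ j ∈ Finset.Ioi i, ‖ζ i - ζ j‖ ^ 2 := by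
  have sep : ∀ i j : Fin M, i < j →
      η / 2 * (((j : ℕ) : ℝ) - ((i : ℕ) : ℝ)) / M ≤ ‖ζ i - ζ j‖ := by
    intro i j hij
    have hM' : (0 : ℝ) < M := by exact_mod_cast i.pos
    have a1 := ((Complex.abs_re_le_norm _).trans_lt (hζ i)).le
    have a2 := ((Complex.abs_re_le_norm _).trans_lt (hζ j)).le
    have a3 := Complex.abs_re_le_norm (ζ i - ζ j)
    have a4 : (x i).re ≤ (x j).re := hx hij.le
    simp only [Complex.sub_re, Complex.add_re, Complex.ofReal_re] at a1 a2 a3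
    have b1 := (abs_le.1 a1).2
    have b2 := (abs_le.1 a2).1
    have b3 := (abs_le.1 a3).1
    have hij' : ((i : ℕ) : ℝ) + 1 ≤ ((j : ℕ) : ℝ) := by exact_mod_cast hij
    -- The two radii `η / (4 * M)` cost at most half of the gap `η * (j - i) / M`, because `j - i ≥
    -- 1`.
    have e1 : η * ((j : ℕ) : ℝ) / M - η * ((i : ℕ) : ℝ) / M - 2 * (η / (4 * M)) -
        η / 2 * (((j : ℕ) : ℝ) - ((i : ℕ) : ℝ)) / M =
        η / 2 / M * (((j : ℕ) : ℝ) - ((i : ℕ) : ℝ) - 1) := by field_simp; ring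
    have e2 : 0 ≤ η / 2 / M * (((j : ℕ) : ℝ) - ((i : ℕ) : ℝ) - 1) :=
      mul_nonneg (by positivity) (by linarith)
    linarith
  calc (η / 2 * Real.exp (-1)) ^ (2 * M * M) =
        ∏ _i : Fin M, ((η / 2 * Real.exp (-1)) ^ M) ^ 2 := by
        rw [Finset.prod_const, Finset.card_univ, Fintype.card_fin, ← pow_mul, ← pow_mul]
        congr 1; ring
    _ ≤ _ := by
      refine Finset.prod_le_prod (fun i _ => by positivity) fun i _ => ?_
      rw [Finset.prod_pow]
      refine pow_le_pow_left₀ (by positivity)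
        ((pow_le_prod_Ioi (by positivity) (by linarith) i).trans ?_) 2
      refine Finset.prod_le_prod (fun j hj => ?_) fun j hj => sep i j (Finset.mem_Ioi.1 hj)
      have hij' : ((i : ℕ) : ℝ) ≤ ((j : ℕ) : ℝ) := by exact_mod_cast (Finset.mem_Ioi.1 hj).le
      exact div_nonneg (mul_nonneg (by positivity) (by linarith)) (by positivity)

/-- The crude estimate `M ≤ exp M` gives the volume the same shape as the interaction bound. -/
theorem pow_le_volume_pi_ball {M : ℕ} {η : ℝ} (h0 : 0 < η) (h1 : η ≤ 1) (y : Fin M → ℂ) :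
    ENNReal.ofReal ((η / 4 * Real.exp (-1)) ^ (2 * M * M)) ≤
      volume (Set.pi Set.univ fun i => Metric.ball (y i) (η / (4 * M))) := by
  have step : ∀ _i : Fin M, (η / 4 * Real.exp (-1)) ^ M ≤ η / (4 * M) := by
    intro i
    have hM' : (0 : ℝ) < M := by exact_mod_cast i.pos
    rw [mul_pow, ← Real.exp_nat_mul, mul_neg_one, Real.exp_neg, div_mul_eq_div_div η 4,
      div_eq_mul_inv (η / 4)]
    have h2 : (M : ℝ) ≤ Real.exp M := by linarith [Real.add_one_le_exp (M : ℝ)]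
    gcongr
    exact pow_le_of_le_one (by positivity) (by linarith) i.pos.ne'
  rw [volume_pi_pi]
  calc ENNReal.ofReal ((η / 4 * Real.exp (-1)) ^ (2 * M * M)) =
        ∏ _i : Fin M, ENNReal.ofReal (((η / 4 * Real.exp (-1)) ^ M) ^ 2) := by
        rw [Finset.prod_const, Finset.card_univ, Fintype.card_fin, ← ENNReal.ofReal_pow,
          ← pow_mul, ← pow_mul]
        · congr 2; ring
        · positivity
    _ ≤ _ := by
      refine Finset.prod_le_prod' fun i _ => ?_
      rw [Complex.volume_ball, ENNReal.ofReal_pow (by positivity)]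
      refine le_mul_of_le_of_one_le (by gcongr; exact step i) ?_
      have h3 : (1 : ℝ≥0) ≤ NNReal.pi := by
        have := Real.pi_gt_three
        exact NNReal.coe_le_coe.1 (by simp; linarith)
      exact_mod_cast h3

/-- Replacing the exponent `2 * (N - M)` by `2 * N` completes the energy at the price of `‖ζ i‖⁻¹ ^
(2 * M) ≥ R⁻¹ ^ (2 * M)` per particle. -/
theorem exp_le_prod_confinement {M N : ℕ} (h : M ≤ N) {R e : ℝ} (hR : 1 ≤ R) {ζ : Fin M → ℂ}
    (h0 : ∀ i, ζ i ≠ 0) (hζR : ∀ i, ‖ζ i‖ ≤ R)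
    (he : ∑ i, (‖ζ i‖ ^ 2 - Real.log (‖ζ i‖ ^ 2)) ≤ M * e) :
    Real.exp (-(N * (M * e))) * R⁻¹ ^ (2 * M * M) ≤
      (∏ i, ‖ζ i‖ ^ (2 * (N - M))) * ∏ i, Real.exp (-(N : ℝ) * ‖ζ i‖ ^ 2) := by
  have hfac : ∀ i, ‖ζ i‖ ^ (2 * (N - M)) * Real.exp (-(N : ℝ) * ‖ζ i‖ ^ 2) =
      Real.exp (-(N : ℝ) * (‖ζ i‖ ^ 2 - Real.log (‖ζ i‖ ^ 2))) * ‖ζ i‖⁻¹ ^ (2 * M) := by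
    intro i
    have hi : 0 < ‖ζ i‖ := norm_pos_iff.2 (h0 i)
    have h2 : Real.exp (-(N : ℝ) * (‖ζ i‖ ^ 2 - Real.log (‖ζ i‖ ^ 2))) =
        Real.exp (-(N : ℝ) * ‖ζ i‖ ^ 2) * ‖ζ i‖ ^ (2 * N) := by
      rw [pow_mul, ← Real.exp_log (pow_pos (pow_pos hi 2) N), Real.log_pow (‖ζ i‖ ^ 2) N,
        ← Real.exp_add]
      congr 1; ring
    have h3 : ‖ζ i‖ ^ (2 * N) = ‖ζ i‖ ^ (2 * (N - M)) * ‖ζ i‖ ^ (2 * M) := by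
      rw [← pow_add]; congr 1; omega
    rw [h2, h3, inv_pow]
    field_simp
  rw [← Finset.prod_mul_distrib, Finset.prod_congr rfl fun i _ => hfac i,
    Finset.prod_mul_distrib, ← Real.exp_sum, ← Finset.mul_sum]
  have hR0 : 0 < R := by linarith
  gcongr
  · rw [neg_mul]; gcongr
  · calc R⁻¹ ^ (2 * M * M) = ∏ _i : Fin M, R⁻¹ ^ (2 * M) := by
          rw [Finset.prod_const, Finset.card_univ, Fintype.card_fin, ← pow_mul]
      _ ≤ _ := by
          gcongr with i
          · exact norm_pos_iff.2 (h0 i)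
          · exact hζR i

/-- Lower bound for the unnormalised mass of a set containing all configurations close to `x`, where
the points of `x` are ordered by their real parts. -/
theorem le_lintegral_weight {M N : ℕ} (h : M ≤ N) {η R e : ℝ} (hη0 : 0 < η) (hη1 : η ≤ 1)
    (hR : 1 ≤ R) {x : Fin M → ℂ} (hx : Monotone fun i => (x i).re) {S : Set (Fin M → ℂ)}
    (hS : ∀ ζ : Fin M → ℂ, (∀ i, ‖ζ i - x i‖ ≤ 2 * η) → ζ ∈ S ∧ (∀ i, ζ i ≠ 0) ∧
      (∀ i, ‖ζ i‖ ≤ R) ∧ ∑ i, (‖ζ i‖ ^ 2 - Real.log (‖ζ i‖ ^ 2)) ≤ M * e) :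
    ENNReal.ofReal (Real.exp (-(N * (M * e))) *
      (R⁻¹ * (η / 2 * Real.exp (-1)) * (η / 4 * Real.exp (-1))) ^ (2 * M * M)) ≤
      ∫⁻ ζ in S, ENNReal.ofReal (weight M N ζ) := by
  set y : Fin M → ℂ := fun i => x i + (η * ((i : ℕ) : ℝ) / M : ℝ) with hy
  set B : Set (Fin M → ℂ) := Set.pi Set.univ fun i => Metric.ball (y i) (η / (4 * M)) with hB
  have hmem : ∀ ζ ∈ B, ∀ i, ‖ζ i - y i‖ < η / (4 * M) := fun ζ hζ i => by
    simpa [dist_eq_norm] using hζ i (Set.mem_univ i)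
  -- The shift and the radius are each at most `η`.
  have hnear : ∀ ζ ∈ B, ∀ i, ‖ζ i - x i‖ ≤ 2 * η := by
    intro ζ hζ i
    have hM' : (0 : ℝ) < M := by exact_mod_cast i.pos
    have hM1 : (1 : ℝ) ≤ M := by exact_mod_cast i.pos
    have hi : ((i : ℕ) : ℝ) ≤ M := by exact_mod_cast i.2.le
    have h1 : ‖y i - x i‖ ≤ η := by
      simp only [hy, add_sub_cancel_left, Complex.norm_real, Real.norm_eq_abs]
      rw [abs_of_nonneg (by positivity), div_le_iff₀ hM']
      gcongr
    have h2 : η / (4 * M) ≤ η := div_le_self hη0.le (by linarith)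
    calc ‖ζ i - x i‖ = ‖(ζ i - y i) + (y i - x i)‖ := by congr 1; ring
      _ ≤ ‖ζ i - y i‖ + ‖y i - x i‖ := norm_add_le _ _
      _ ≤ 2 * η := by linarith [hmem ζ hζ i]
  have hBm : MeasurableSet B := MeasurableSet.univ_pi fun i => measurableSet_ball
  set c : ℝ := Real.exp (-(N * (M * e))) * R⁻¹ ^ (2 * M * M) *
    (η / 2 * Real.exp (-1)) ^ (2 * M * M) with hc
  have hR0 : 0 < R := by linarith
  have hw : ∀ ζ ∈ B, c ≤ weight M N ζ := by
    intro ζ hζ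
    obtain ⟨-, h0, hζR, he⟩ := hS ζ (hnear ζ hζ)
    have a := exp_le_prod_confinement h hR h0 hζR he
    have b := pow_le_prod_norm_sub hη0 hη1 hx (hmem ζ hζ)
    unfold weight
    rw [mul_right_comm]
    exact mul_le_mul a b (by positivity) (by positivity)
  calc _ = ENNReal.ofReal c * ENNReal.ofReal ((η / 4 * Real.exp (-1)) ^ (2 * M * M)) := by
        rw [← ENNReal.ofReal_mul (by positivity), hc]
        congr 1
        rw [mul_pow, mul_pow]; ring
    _ ≤ ENNReal.ofReal c * volume B := by gcongr; exact pow_le_volume_pi_ball hη0 hη1 y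
    _ = ∫⁻ ζ in B, ENNReal.ofReal c := (setLIntegral_const _ _).symm
    _ ≤ ∫⁻ ζ in B, ENNReal.ofReal (weight M N ζ) :=
        setLIntegral_mono' hBm fun ζ hζ => ENNReal.ofReal_le_ofReal (hw ζ hζ)
    _ ≤ _ := lintegral_mono_set fun ζ hζ => (hS ζ (hnear ζ hζ)).1

/-! ### Approximation by samples and by compactly supported measures -/

/-- Almost every realisation of an i.i.d. sample from `ν` works, by the strong law of large numbers;
one suffices. -/
theorem exists_seq_tendsto_average {X F : Type} [MeasurableSpace X] [NormedAddCommGroup F]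
    [NormedSpace ℝ F] [CompleteSpace F] [MeasurableSpace F] [BorelSpace F] (ν : Measure X)
    [IsProbabilityMeasure ν] {K : Set X} (hK : ∀ᵐ z ∂ν, z ∈ K) {Φ : X → F} (hm : Measurable Φ)
    (hΦ : Integrable Φ ν) :
    ∃ x : ℕ → X, (∀ n, x n ∈ K) ∧
      Tendsto (fun n : ℕ => (n : ℝ)⁻¹ • ∑ i ∈ Finset.range n, Φ (x i)) atTop
        (𝓝 (∫ z, Φ z ∂ν)) := by
  obtain ⟨Ω, _, P, Y, hYm, hYl, hYi, hP⟩ := ProbabilityTheory.exists_iid ℕ ν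
  have hlaw : ∀ i, P.map (Y i) = ν := fun i => (hYl i).map_eq
  have hint : Integrable (fun ω => Φ (Y 0 ω)) P := by
    have := hΦ
    rw [← hlaw 0] at this
    exact this.comp_measurable (hYm 0)
  have hident : ∀ i, ProbabilityTheory.IdentDistrib (fun ω => Φ (Y i ω)) (fun ω => Φ (Y 0 ω)) P P :=
    fun i => ProbabilityTheory.IdentDistrib.comp
      ⟨(hYm i).aemeasurable, (hYm 0).aemeasurable, (hlaw i).trans (hlaw 0).symm⟩ hm
  have h1 := ProbabilityTheory.strong_law_ae (μ := P) (fun i ω => Φ (Y i ω)) hint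
    (fun i j hij => (hYi.indepFun hij).comp hm hm) hident
  have h2 : ∀ᵐ ω ∂P, ∀ i, Y i ω ∈ K := by
    rw [ae_all_iff]
    intro i
    rw [← hlaw i] at hK
    exact ae_of_ae_map (hYm i).aemeasurable hK
  obtain ⟨ω, hω1, hω2⟩ := (h1.and h2).exists
  refine ⟨fun n => Y n ω, hω2, ?_⟩
  have h3 : ∫ z, Φ z ∂ν = ∫ ω, Φ (Y 0 ω) ∂P := by
    rw [← hlaw 0, integral_map (hYm 0).aemeasurable]
    rw [hlaw 0]; exact hΦ.aestronglyMeasurable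
  rw [h3]
  exact hω1

theorem exists_finite_test_functions {μ : ProbabilityMeasure ℂ} {O : Set (ProbabilityMeasure ℂ)}
    (hO : O ∈ 𝓝 μ) :
    ∃ (I : Finset (BoundedContinuousFunction ℂ ℝ)) (W : BoundedContinuousFunction ℂ ℝ → Set ℝ),
      (∀ f, W f ∈ 𝓝 (∫ z, f z ∂(μ : Measure ℂ))) ∧
      ∀ ν : ProbabilityMeasure ℂ, (∀ f ∈ I, ∫ z, f z ∂(ν : Measure ℂ) ∈ W f) → ν ∈ O := by
  have h : Tendsto id (⨅ f : BoundedContinuousFunction ℂ ℝ,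
      comap (fun ν : ProbabilityMeasure ℂ => ∫ z, f z ∂(ν : Measure ℂ))
        (𝓝 (∫ z, f z ∂(μ : Measure ℂ)))) (𝓝 μ) :=
    ProbabilityMeasure.tendsto_iff_forall_integral_tendsto.2 fun f =>
      tendsto_comap.mono_left (iInf_le _ f)
  obtain ⟨I, hI, V, hV, -, hOV, -⟩ := mem_iInf'.1 (h hO)
  choose W hW hWV using fun f => mem_comap.1 (hV f)
  refine ⟨hI.toFinset, W, hW, fun ν hν => ?_⟩
  have : ν ∈ id ⁻¹' O := by
    rw [hOV]
    exact Set.mem_iInter₂.2 fun f hf => hWV f (hν f (hI.mem_toFinset.2 hf))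
  exact this

theorem continuousAt_sub_log {z : ℂ} (hz : z ≠ 0) :
    ContinuousAt (fun z : ℂ => ‖z‖ ^ 2 - Real.log (‖z‖ ^ 2)) z :=
  ContinuousAt.sub (by fun_prop) (ContinuousAt.log (by fun_prop) (by positivity))

/-- By the law of large numbers, a neighbourhood of `ν` contains the empirical measures of all
configurations uniformly close to suitable ones, with control of the energy. -/
theorem exists_near_configurations {ν : ProbabilityMeasure ℂ} {K : Set ℂ} (hKc : IsCompact K)
    (hK0 : (0 : ℂ) ∉ K) (hK : ∀ᵐ z ∂(ν : Measure ℂ), z ∈ K) {O : Set (ProbabilityMeasure ℂ)}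
    (hO : O ∈ 𝓝 ν) {e : ℝ} (he : ∫ z, (‖z‖ ^ 2 - Real.log (‖z‖ ^ 2)) ∂(ν : Measure ℂ) < e) :
    ∃ η R : ℝ, 0 < η ∧ η ≤ 1 ∧ 1 ≤ R ∧ ∀ᶠ M : ℕ in atTop, ∃ x : Fin M → ℂ,
      Monotone (fun i => (x i).re) ∧ ∀ ζ : Fin M → ℂ, (∀ i, ‖ζ i - x i‖ ≤ 2 * η) →
        empiricalMeasure M ζ ∈ O ∧ (∀ i, ζ i ≠ 0) ∧ (∀ i, ‖ζ i‖ ≤ R) ∧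
          ∑ i, (‖ζ i‖ ^ 2 - Real.log (‖ζ i‖ ^ 2)) ≤ M * e := by
  obtain ⟨I, W, hW, htest⟩ := exists_finite_test_functions hO
  -- One vector-valued function carries both the test functions and the energy, so a single law of
  -- large numbers serves.
  set Φ : ℂ → (I → ℝ) × ℝ := fun z => (fun f => f.1 z, ‖z‖ ^ 2 - Real.log (‖z‖ ^ 2)) with hΦdef
  have hΦm : Measurable Φ := by
    refine Measurable.prodMk (measurable_pi_lambda _ fun f => f.1.continuous.measurable) ?_
    fun_prop
  have hΦc : ∀ z ≠ 0, ContinuousAt Φ z := fun z hz =>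
    ContinuousAt.prodMk (continuous_pi fun f : I => f.1.continuous).continuousAt
      (continuousAt_sub_log hz)
  have hK0' : ∀ z ∈ K, z ≠ 0 := fun z hz h => hK0 (h ▸ hz)
  have hΦi : Integrable Φ (ν : Measure ℂ) := by
    have : IntegrableOn Φ K (ν : Measure ℂ) := ContinuousOn.integrableOn_compact hKc fun z hz =>
      (hΦc z (hK0' z hz)).continuousWithinAt
    rwa [IntegrableOn, Measure.restrict_eq_self_of_ae_mem hK] at this
  obtain ⟨x, hxK, hx⟩ := exists_seq_tendsto_average (ν : Measure ℂ) hK hΦm hΦi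
  have hfst : ∀ f : I, (∫ z, Φ z ∂(ν : Measure ℂ)).1 f = ∫ z, f.1 z ∂(ν : Measure ℂ) := fun f =>
    (((ContinuousLinearMap.proj (R := ℝ) (φ := fun _ : I => ℝ) f).comp
      (ContinuousLinearMap.fst ℝ (I → ℝ) ℝ)).integral_comp_comm hΦi).symm
  have hsnd : (∫ z, Φ z ∂(ν : Measure ℂ)).2 < e := by
    have := (ContinuousLinearMap.snd ℝ (I → ℝ) ℝ).integral_comp_comm hΦi
    exact this.symm.trans_lt he
  set G : Set ((I → ℝ) × ℝ) := {p | (∀ f, p.1 f ∈ W f.1) ∧ p.2 < e} with hG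
  have hGn : G ∈ 𝓝 (∫ z, Φ z ∂(ν : Measure ℂ)) := by
    refine inter_mem (eventually_all.2 fun f => ?_)
      ((continuous_snd.isOpen_preimage _ isOpen_Iio).mem_nhds hsnd)
    have hc : Continuous fun p : (I → ℝ) × ℝ => p.1 f := by fun_prop
    refine hc.continuousAt.preimage_mem_nhds ?_
    rw [hfst]; exact hW f.1
  obtain ⟨ρ, hρ, hρG⟩ := Metric.mem_nhds_iff.1 hGn
  -- Only one of the two compared points has to lie in `K`.
  have hU := hKc.uniformContinuousAt_of_continuousAt Φ (fun z hz => hΦc z (hK0' z hz))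
    (Metric.dist_mem_uniformity (half_pos hρ))
  obtain ⟨δ, hδ, hδU⟩ := Metric.mem_uniformity_dist.1 hU
  obtain ⟨δ', hδ', hδK⟩ := hKc.exists_thickening_subset_open isOpen_compl_singleton
    (fun z hz => hK0' z hz : K ⊆ {0}ᶜ)
  obtain ⟨R, hR⟩ := hKc.isBounded.exists_norm_le
  have hη : 0 < min 1 (min (δ / 4) (δ' / 4)) := by positivity
  set η := min 1 (min (δ / 4) (δ' / 4))
  have hη1 : η ≤ 1 := min_le_left _ _
  have hη2 : η ≤ δ / 4 := (min_le_right _ _).trans (min_le_left _ _)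
  have hη3 : η ≤ δ' / 4 := (min_le_right _ _).trans (min_le_right _ _)
  refine ⟨η, max 1 (R + 2), hη, hη1, le_max_left _ _, ?_⟩
  filter_upwards [hx.eventually (Metric.ball_mem_nhds _ (half_pos hρ)), eventually_gt_atTop 0]
    with M hM hM0
  have hM' : (0 : ℝ) < M := by exact_mod_cast hM0
  -- Sorting orders the real parts and leaves the average unchanged.
  set σ := Tuple.sort fun i : Fin M => (x i).re
  refine ⟨fun i => x (σ i), Tuple.monotone_sort fun i : Fin M => (x i).re, fun ζ hζ => ?_⟩
  have hd : ∀ i, dist (Φ (x (σ i))) (Φ (ζ i)) < ρ / 2 := fun i => by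
    refine hδU (a := x (σ i)) (b := ζ i) ?_ (hxK _)
    rw [dist_comm, dist_eq_norm]
    linarith [hζ i]
  have h0 : ∀ i, ζ i ≠ 0 := fun i => by
    refine hδK (Metric.mem_thickening_iff.2 ⟨x (σ i), hxK _, ?_⟩)
    rw [dist_eq_norm]
    linarith [hζ i]
  have hmem : (M : ℝ)⁻¹ • ∑ i, Φ (ζ i) ∈ G := by
    refine hρG ?_
    rw [Metric.mem_ball]
    have hperm : ∑ i ∈ Finset.range M, Φ (x i) = ∑ i : Fin M, Φ (x (σ i)) := by
      rw [Finset.sum_range, Equiv.sum_comp σ fun i : Fin M => Φ (x i)]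
    rw [hperm] at hM
    have h1 : dist ((M : ℝ)⁻¹ • ∑ i, Φ (ζ i)) ((M : ℝ)⁻¹ • ∑ i, Φ (x (σ i))) ≤ ρ / 2 := by
      rw [dist_eq_norm, ← smul_sub, ← Finset.sum_sub_distrib, norm_smul, norm_inv,
        Real.norm_natCast, inv_mul_le_iff₀ hM']
      calc _ ≤ ∑ _i : Fin M, ρ / 2 := norm_sum_le_of_le _ fun i _ => by
              rw [← dist_eq_norm, dist_comm]; exact (hd i).le
        _ = _ := by simp
    linarith [dist_triangle ((M : ℝ)⁻¹ • ∑ i, Φ (ζ i)) ((M : ℝ)⁻¹ • ∑ i, Φ (x (σ i)))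
      (∫ z, Φ z ∂(ν : Measure ℂ))]
  refine ⟨htest _ fun f hf => ?_, h0, fun i => ?_, ?_⟩
  · rw [integral_empiricalMeasure hM0]
    have := hmem.1 ⟨f, hf⟩
    simpa [hΦdef, Prod.fst_sum, Finset.sum_apply] using this
  · have h1 : ‖ζ i‖ ≤ ‖ζ i - x (σ i)‖ + ‖x (σ i)‖ := by
      simpa using norm_add_le (ζ i - x (σ i)) (x (σ i))
    exact le_max_of_le_right (by linarith [hζ i, hR _ (hxK (σ i))])
  · have := hmem.2
    simp only [hΦdef, Prod.smul_snd, Prod.snd_sum, smul_eq_mul] at this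
    rw [inv_mul_lt_iff₀ hM'] at this
    exact this.le

/-- A probability measure of finite energy is approximated, together with its energy, by probability
measures with compact support in the punctured plane. -/
theorem exists_compactly_supported {μ : ProbabilityMeasure ℂ} (hμ : energy μ ≠ ⊤)
    {O : Set (ProbabilityMeasure ℂ)} (hO : O ∈ 𝓝 μ) {e : ℝ≥0∞} (he : energy μ < e) :
    ∃ (ν : ProbabilityMeasure ℂ) (K : Set ℂ), IsCompact K ∧ (0 : ℂ) ∉ K ∧
      (∀ᵐ z ∂(ν : Measure ℂ), z ∈ K) ∧ ν ∈ O ∧ energy ν < e := by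
  set A : ℕ → Set ℂ := fun n => {z | ((n : ℝ) + 1)⁻¹ ≤ ‖z‖ ∧ ‖z‖ ≤ n + 1} with hA
  have hAclosed : ∀ n, IsClosed (A n) := fun n =>
    (isClosed_le continuous_const continuous_norm).inter
      (isClosed_le continuous_norm continuous_const)
  have hAm : ∀ n, MeasurableSet (A n) := fun n => (hAclosed n).measurableSet
  have hAc : ∀ n, IsCompact (A n) := fun n =>
    (isCompact_closedBall (0 : ℂ) (n + 1)).of_isClosed_subset (hAclosed n) fun z hz => by
      simpa using hz.2
  have hAmono : Monotone A := by
    intro m n hmn z hz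
    have : (m : ℝ) ≤ n := by exact_mod_cast hmn
    exact ⟨le_trans (by gcongr) hz.1, hz.2.trans (by gcongr)⟩
  have hAU : ⋃ n, A n = {0}ᶜ := by
    ext z
    simp only [Set.mem_iUnion, Set.mem_compl_iff, Set.mem_singleton_iff]
    constructor
    · rintro ⟨n, hn⟩ rfl
      have h1 : ((n : ℝ) + 1)⁻¹ ≤ 0 := by simpa using hn.1
      exact absurd h1 (not_le.2 (by positivity))
    · intro hz
      have hz' : 0 < ‖z‖ := norm_pos_iff.2 hz
      obtain ⟨n, hn⟩ := exists_nat_ge (max ‖z‖ ‖z‖⁻¹)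
      refine ⟨n, ?_, by linarith [le_max_left ‖z‖ ‖z‖⁻¹]⟩
      exact inv_le_of_inv_le₀ hz' (by linarith [le_max_right ‖z‖ ‖z‖⁻¹])
  -- Finite energy forbids mass at the origin, so the annuli exhaust `μ`, and conditioning on them
  -- approximates it.
  have hne : ∀ᵐ z ∂(μ : Measure ℂ), z ∈ ⋃ n, A n := by
    filter_upwards [ae_lt_top continuous_potential.measurable hμ] with z hz
    rw [hAU]
    rintro rfl
    simp [potential] at hz
  have hp : Tendsto (fun n => (μ : Measure ℂ) (A n)) atTop (𝓝 1) := by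
    have := tendsto_measure_iUnion_atTop (μ := (μ : Measure ℂ)) hAmono
    rwa [(prob_compl_eq_zero_iff (MeasurableSet.iUnion hAm)).1 hne] at this
  have hpos : ∀ᶠ n in atTop, (μ : Measure ℂ) (A n) ≠ 0 :=
    hp.eventually_ne one_ne_zero
  have hpinv : Tendsto (fun n => ((μ : Measure ℂ) (A n))⁻¹) atTop (𝓝 1) := by
    simpa using hp.inv
  classical
  set ν : ℕ → ProbabilityMeasure ℂ := fun n =>
    if h : (μ : Measure ℂ) (A n) ≠ 0 then
      ⟨ProbabilityTheory.cond μ (A n), ProbabilityTheory.cond_isProbabilityMeasure h⟩ else μ with hν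
  have hνc : ∀ n, (μ : Measure ℂ) (A n) ≠ 0 →
      (ν n : Measure ℂ) = ((μ : Measure ℂ) (A n))⁻¹ • (μ : Measure ℂ).restrict (A n) := by
    intro n hn
    simp [hν, hn, ProbabilityTheory.cond]
  have hlim : Tendsto ν atTop (𝓝 μ) := by
    rw [ProbabilityMeasure.tendsto_iff_forall_integral_tendsto]
    intro f
    have h1 : Tendsto (fun n => ∫ z in A n, f z ∂(μ : Measure ℂ)) atTop
        (𝓝 (∫ z, f z ∂(μ : Measure ℂ))) := by
      have := tendsto_setIntegral_of_monotone (μ := (μ : Measure ℂ)) hAm hAmono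
        (f.integrable (μ : Measure ℂ)).integrableOn
      rwa [Measure.restrict_eq_self_of_ae_mem hne] at this
    have h2 := ((ENNReal.tendsto_toReal ENNReal.one_ne_top).comp hpinv).mul h1
    rw [ENNReal.toReal_one, one_mul] at h2
    refine h2.congr' ?_
    filter_upwards [hpos] with n hn
    rw [hνc n hn, integral_smul_measure, smul_eq_mul]
    rfl
  have hen : ∀ᶠ n in atTop, ((μ : Measure ℂ) (A n))⁻¹ * energy μ < e := by
    have h1 := ENNReal.Tendsto.mul_const hpinv (Or.inr hμ)
    rw [one_mul] at h1
    exact h1.eventually (gt_mem_nhds he)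
  obtain ⟨n, hn, hnO, hne⟩ := (hpos.and ((hlim.eventually hO).and hen)).exists
  refine ⟨ν n, A n, hAc n, ?_, ?_, hnO, lt_of_le_of_lt ?_ hne⟩
  · intro h
    have h1 : ((n : ℝ) + 1)⁻¹ ≤ 0 := by simpa using h.1
    exact absurd h1 (not_le.2 (by positivity))
  · rw [hνc n hn]
    exact Measure.ae_smul_measure (ae_restrict_mem (hAm n)) _
  · rw [energy, hνc n hn, lintegral_smul_measure, smul_eq_mul]
    gcongr
    exact setLIntegral_le_lintegral _ _

theorem integral_eq_toReal_energy {ν : ProbabilityMeasure ℂ}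
    (h0 : ∀ᵐ z ∂(ν : Measure ℂ), z ≠ 0) :
    ∫ z, (‖z‖ ^ 2 - Real.log (‖z‖ ^ 2)) ∂(ν : Measure ℂ) = (energy ν).toReal := by
  rw [integral_eq_lintegral_of_nonneg_ae]
  · congr 1
    refine lintegral_congr_ae ?_
    filter_upwards [h0] with z hz
    simp [potential, hz]
  · filter_upwards [h0] with z hz using zero_le_one.trans (one_le_sub_log hz)
  · exact Measurable.aestronglyMeasurable (by fun_prop)

theorem eventually_le_lintegral_weight {μ : ProbabilityMeasure ℂ} {O : Set (ProbabilityMeasure ℂ)}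
    (hO : IsOpen O) (hμO : μ ∈ O) {e : ℝ} (he : energy μ < ENNReal.ofReal e) :
    ∃ C : ℝ, ∀ᶠ M : ℕ in atTop, ∀ N, M ≤ N →
      ENNReal.ofReal (Real.exp (-(N * (M * e)) - C * (M * M))) ≤
        ∫⁻ ζ in empiricalMeasure M ⁻¹' O, ENNReal.ofReal (weight M N ζ) := by
  obtain ⟨ν, K, hKc, hK0, hK, hνO, hνe⟩ :=
    exists_compactly_supported he.ne_top (hO.mem_nhds hμO) he
  have hν0 : ∀ᵐ z ∂(ν : Measure ℂ), z ≠ 0 := hK.mono fun z hz h => hK0 (h ▸ hz)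
  have hνe' : ∫ z, (‖z‖ ^ 2 - Real.log (‖z‖ ^ 2)) ∂(ν : Measure ℂ) < e := by
    rw [integral_eq_toReal_energy hν0]
    exact (ENNReal.lt_ofReal_iff_toReal_lt hνe.ne_top).1 hνe
  obtain ⟨η, R, hη0, hη1, hR, hx⟩ := exists_near_configurations hKc hK0 hK (hO.mem_nhds hνO) hνe'
  set δ : ℝ := R⁻¹ * (η / 2 * Real.exp (-1)) * (η / 4 * Real.exp (-1)) with hδ
  have hδ0 : 0 < δ := by
    have : 0 < R := by linarith
    positivity
  -- `δ ^ (2 * M * M) = exp (-C * M ^ 2)`, and `δ` depends on neither `M` nor `N`.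
  refine ⟨-2 * Real.log δ, ?_⟩
  filter_upwards [hx] with M ⟨x, hxm, hx⟩ N hMN
  have h := le_lintegral_weight hMN hη0 hη1 hR hxm (S := empiricalMeasure M ⁻¹' O) hx
  convert h using 2
  rw [sub_eq_add_neg, Real.exp_add, ← hδ, ← Real.exp_log (pow_pos hδ0 (2 * M * M)), Real.log_pow]
  congr 2
  push_cast; ring

/-! ### Goodness of the rate function -/

/-- The energy is the supremum of the integrals of the truncations `min potential n`, which are
bounded and continuous, so each integral is weakly continuous. -/
theorem lowerSemicontinuous_energy : LowerSemicontinuous energy := by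
  set f : ℕ → ℂ → ℝ≥0 := fun n z => (min (potential z) n).toNNReal with hf
  have hcoe : ∀ n z, (f n z : ℝ≥0∞) = min (potential z) n := fun n z =>
    ENNReal.coe_toNNReal (ne_top_of_le_ne_top (ENNReal.natCast_ne_top n) (min_le_right _ _))
  have hle : ∀ n z, f n z ≤ n := fun n z => by
    have : (f n z : ℝ≥0∞) ≤ n := (hcoe n z).trans_le (min_le_right _ _)
    exact_mod_cast this
  have hfc : ∀ n, Continuous (f n) := fun n => by
    refine ENNReal.continuousOn_toNNReal.comp_continuous
      (continuous_potential.min continuous_const) fun z => ?_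
    exact ne_top_of_le_ne_top (ENNReal.natCast_ne_top n) (min_le_right _ _)
  have hsup : energy = fun μ : ProbabilityMeasure ℂ =>
      ⨆ n, ∫⁻ z, (f n z : ℝ≥0∞) ∂(μ : Measure ℂ) := by
    funext μ
    rw [← lintegral_iSup (fun n => (hfc n).measurable.coe_nnreal_ennreal)]
    · refine lintegral_congr fun z => ?_
      simp_rw [hcoe]
      rw [← inf_iSup_eq, ENNReal.iSup_natCast, inf_top_eq]
    · intro m n hmn z
      simp only [hcoe]
      gcongr
  rw [hsup]
  refine lowerSemicontinuous_iSup fun n => Continuous.lowerSemicontinuous ?_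
  exact ProbabilityMeasure.continuous_iff_forall_continuous_lintegral.1 continuous_id
    (BoundedContinuousFunction.mkOfBound ⟨f n, hfc n⟩ n fun x y => by
      rw [NNReal.dist_eq]
      have h1 : (f n x : ℝ) ≤ n := by exact_mod_cast hle n x
      have h2 : (f n y : ℝ) ≤ n := by exact_mod_cast hle n y
      exact abs_sub_le_iff.2 ⟨by simp; linarith [(f n y).2], by simp; linarith [(f n x).2]⟩)

theorem half_norm_sq_le_potential (z : ℂ) : ENNReal.ofReal (‖z‖ ^ 2 / 2) ≤ potential z := by
  by_cases hz : z = 0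
  · simp [hz]
  · simp only [potential, hz, if_false]
    refine ENNReal.ofReal_le_ofReal ?_
    have h : 0 < ‖z‖ ^ 2 := by positivity
    have h1 := Real.log_le_sub_one_of_pos (half_pos h)
    rw [Real.log_div h.ne' two_ne_zero] at h1
    linarith [Real.log_two_lt_d9]

/-- Markov's inequality, applied to the quadratic growth of the potential. -/
theorem isTightMeasureSet_energy_le {b : ℝ≥0∞} (hb : b ≠ ⊤) :
    IsTightMeasureSet {x : Measure ℂ |
      ∃ μ ∈ {μ : ProbabilityMeasure ℂ | energy μ ≤ b}, (μ : Measure ℂ) = x} := by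
  rw [isTightMeasureSet_iff_exists_isCompact_measure_compl_le]
  intro ε hε
  have hbε : b / ε ≠ ⊤ := ENNReal.div_ne_top hb hε.ne'
  set t := (b / ε).toReal with ht
  have ht0 : 0 ≤ t := ENNReal.toReal_nonneg
  refine ⟨Metric.closedBall 0 (t + 1), isCompact_closedBall _ _, ?_⟩
  rintro _ ⟨μ, hμ, rfl⟩
  have hsub : (Metric.closedBall (0 : ℂ) (t + 1))ᶜ ⊆
      {z | ENNReal.ofReal ((t + 1) ^ 2 / 2) ≤ potential z} := by
    intro z hz
    have hz' : t + 1 < ‖z‖ := by simpa using hz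
    refine le_trans (ENNReal.ofReal_le_ofReal ?_) (half_norm_sq_le_potential z)
    gcongr
  have h1 := mul_meas_ge_le_lintegral (μ := (μ : Measure ℂ)) continuous_potential.measurable
    (ENNReal.ofReal ((t + 1) ^ 2 / 2))
  have hpos : 0 < (t + 1) ^ 2 / 2 := by positivity
  have h2 : b / ε ≤ ENNReal.ofReal ((t + 1) ^ 2 / 2) := by
    rw [← ENNReal.ofReal_toReal hbε]
    exact ENNReal.ofReal_le_ofReal (by nlinarith)
  have h3 : (μ : Measure ℂ) (Metric.closedBall (0 : ℂ) (t + 1))ᶜ ≤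
      b / ENNReal.ofReal ((t + 1) ^ 2 / 2) := by
    rw [ENNReal.le_div_iff_mul_le (Or.inl (by simpa using hpos)) (Or.inl ENNReal.ofReal_ne_top),
      mul_comm]
    exact (mul_le_mul_right (measure_mono hsub) _).trans (h1.trans hμ)
  refine h3.trans ?_
  by_cases hε' : ε = ⊤
  · simp [hε']
  rw [ENNReal.div_le_iff_le_mul (Or.inl (by simpa using hpos)) (Or.inl ENNReal.ofReal_ne_top)]
  rw [ENNReal.div_le_iff_le_mul (Or.inl hε.ne') (Or.inl hε')] at h2
  rwa [mul_comm]

theorem isCompact_energy_le {b : ℝ≥0∞} (hb : b ≠ ⊤) :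
    IsCompact {μ : ProbabilityMeasure ℂ | energy μ ≤ b} := by
  have h := isCompact_closure_of_isTightMeasureSet (isTightMeasureSet_energy_le hb)
  have hc : IsClosed {μ : ProbabilityMeasure ℂ | energy μ ≤ b} :=
    lowerSemicontinuous_energy.isClosed_preimage b
  rwa [hc.closure_eq] at h

theorem minEnergy_le (μ : ProbabilityMeasure ℂ) : minEnergy ≤ energy μ := iInf_le _ μ

theorem lowerSemicontinuous_rateFunction : LowerSemicontinuous rateFunction :=
  (ENNReal.continuous_sub_right minEnergy).comp_lowerSemicontinuous lowerSemicontinuous_energy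
    fun _ _ h => tsub_le_tsub_right h _

theorem isCompact_rateFunction_le (c : ℝ≥0) :
    IsCompact {μ | rateFunction μ ≤ (c : ℝ≥0∞)} := by
  have h : {μ | rateFunction μ ≤ (c : ℝ≥0∞)} = {μ | energy μ ≤ c + minEnergy} := by
    ext μ
    exact tsub_le_iff_right (α := ℝ≥0∞)
  rw [h]
  exact isCompact_energy_le (by simp [minEnergy_ne_top])

/-! ### Normalisation -/

/-- The continuous weight is positive at the distinct nonzero points `1, …, M`, hence on a nonempty
open set. -/
theorem normConst_ne_zero (M N : ℕ) : normConst M N ≠ 0 := by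
  have hc : Continuous fun ζ : Fin M → ℂ => ENNReal.ofReal (weight M N ζ) :=
    ENNReal.continuous_ofReal.comp (continuous_weight M N)
  refine (lintegral_pos_iff_support hc.measurable |>.2 ?_).ne'
  refine hc.isOpen_support.measure_pos volume ⟨fun i => ((i : ℕ) : ℂ) + 1, ?_⟩
  rw [Function.mem_support, Ne, ENNReal.ofReal_eq_zero, not_le]
  refine (weight_nonneg _ _ _).lt_of_ne' ?_
  have h1 : ∀ i : Fin M, ((i : ℕ) : ℂ) + 1 ≠ 0 := fun i => Nat.cast_add_one_ne_zero _
  have h2 : ∀ i j : Fin M, i < j → ((i : ℕ) : ℂ) - ((j : ℕ) : ℂ) ≠ 0 := fun i j hij h =>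
    hij.ne (Fin.ext (by exact_mod_cast sub_eq_zero.1 h))
  simp only [weight, mul_ne_zero_iff, Finset.prod_ne_zero_iff]
  refine ⟨⟨fun i _ => pow_ne_zero _ (norm_ne_zero_iff.2 (h1 i)), fun i _ j hj =>
    pow_ne_zero _ (norm_ne_zero_iff.2 ?_)⟩, fun i _ => (Real.exp_pos _).ne'⟩
  simpa using h2 i j (Finset.mem_Ioi.1 hj)

theorem law_apply (M N : ℕ) (S : Set (Fin M → ℂ)) :
    law M N S = (∫⁻ ζ in S, ENNReal.ofReal (weight M N ζ)) / normConst M N := by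
  have hc : Continuous fun ζ : Fin M → ℂ => ENNReal.ofReal (weight M N ζ) :=
    ENNReal.continuous_ofReal.comp (continuous_weight M N)
  rw [law, withDensity_apply']
  simp_rw [div_eq_mul_inv]
  rw [lintegral_mul_const _ hc.measurable]

theorem isProbabilityMeasure_law {M N : ℕ} (h : M ≤ N) : IsProbabilityMeasure (law M N) := by
  constructor
  rw [law_apply, Measure.restrict_univ]
  exact ENNReal.div_self (normConst_ne_zero M N) (normConst_ne_top h)

/-! ### Asymptotics at speed `N * M` -/

theorem limsup_log_div_le {p : ℕ → ℝ≥0∞} {t a : ℕ → ℝ} {L : ℝ}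
    (hp : ∀ᶠ n in atTop, p n ≤ ENNReal.ofReal (Real.exp (t n))) (ha : ∀ᶠ n in atTop, 0 ≤ a n)
    (ht : Tendsto (fun n => t n / a n) atTop (𝓝 L)) :
    limsup (fun n => ENNReal.log (p n) / ((a n : ℝ) : EReal)) atTop ≤ (L : EReal) := by
  rw [← ((continuous_coe_real_ereal.tendsto L).comp ht).limsup_eq]
  refine limsup_le_limsup ?_
  filter_upwards [hp, ha] with n hn han
  have h := ENNReal.log_le_log hn
  rw [ENNReal.log_ofReal_of_pos (Real.exp_pos _), Real.log_exp] at h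
  exact EReal.div_le_div_right_of_nonneg (EReal.coe_nonneg.2 han) h

theorem le_liminf_log_div {p : ℕ → ℝ≥0∞} {t a : ℕ → ℝ} {L : ℝ}
    (hp : ∀ᶠ n in atTop, ENNReal.ofReal (Real.exp (t n)) ≤ p n) (ha : ∀ᶠ n in atTop, 0 ≤ a n)
    (ht : Tendsto (fun n => t n / a n) atTop (𝓝 L)) :
    (L : EReal) ≤ liminf (fun n => ENNReal.log (p n) / ((a n : ℝ) : EReal)) atTop := by
  rw [← ((continuous_coe_real_ereal.tendsto L).comp ht).liminf_eq]
  refine liminf_le_liminf ?_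
  filter_upwards [hp, ha] with n hn han
  have h := ENNReal.log_le_log hn
  rw [ENNReal.log_ofReal_of_pos (Real.exp_pos _), Real.log_exp] at h
  exact EReal.div_le_div_right_of_nonneg (EReal.coe_nonneg.2 han) h

section Asymptotics

variable {N : ℕ → ℕ}

theorem eventually_lt_of_tendsto_div (hMN : ∀ᶠ M : ℕ in atTop, M ≤ N M)
    (hN : Tendsto (fun M : ℕ => (M : ℝ) / (N M : ℝ)) atTop (𝓝 0)) :
    ∀ᶠ M : ℕ in atTop, M < N M := by
  filter_upwards [hMN, hN.eventually (gt_mem_nhds one_pos), eventually_gt_atTop 0] with M h1 h2 h3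
  have : (0 : ℝ) < N M := by exact_mod_cast h3.trans_le h1
  rw [div_lt_one this] at h2
  exact_mod_cast h2

/-- This is the exponent of the upper estimate over the lower one. Besides `e - c` the quotient
contains only `(c + C) * M / N` and `log π / N`. -/
theorem tendsto_exponent_div (hMN : ∀ᶠ M : ℕ in atTop, M ≤ N M)
    (hN : Tendsto (fun M : ℕ => (M : ℝ) / (N M : ℝ)) atTop (𝓝 0)) (c e C : ℝ) :
    Tendsto (fun M : ℕ => (-((N M - M) * (M * c)) + M * Real.log Real.pi -
      (-(N M * (M * e)) - C * (M * M))) / ((N M : ℝ) * M)) atTop (𝓝 (e - c)) := by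
  have hNinf : Tendsto (fun M => ((N M : ℕ) : ℝ)) atTop atTop :=
    tendsto_natCast_atTop_atTop.comp (tendsto_atTop_mono' _ hMN tendsto_id)
  have h1 := (hN.const_mul (c + C)).add (hNinf.inv_tendsto_atTop.const_mul (Real.log Real.pi))
  have h2 := h1.add (tendsto_const_nhds (x := e - c))
  simp only [mul_zero, zero_add] at h2
  refine h2.congr' ?_
  filter_upwards [hMN, eventually_gt_atTop 0] with M hM hM0
  have a1 : (0 : ℝ) < M := by exact_mod_cast hM0
  have a2 : (0 : ℝ) < N M := by exact_mod_cast hM0.trans_le hM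
  simp only [Pi.inv_apply]
  field_simp
  ring

theorem exp_mul_pi_pow (M : ℕ) (s : ℝ) :
    Real.exp s * Real.pi ^ M = Real.exp (s + M * Real.log Real.pi) := by
  rw [Real.exp_add, Real.exp_nat_mul, Real.exp_log Real.pi_pos]

theorem limsup_log_law_le (hMN : ∀ᶠ M : ℕ in atTop, M ≤ N M)
    (hN : Tendsto (fun M : ℕ => (M : ℝ) / (N M : ℝ)) atTop (𝓝 0))
    {F : Set (ProbabilityMeasure ℂ)} {c e : ℝ} (hF : ∀ μ ∈ F, ENNReal.ofReal c ≤ energy μ)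
    (he : minEnergy < ENNReal.ofReal e) :
    limsup (fun M => ENNReal.log (law M (N M) (empiricalMeasure M ⁻¹' F)) /
      (((N M : ℝ) * (M : ℝ) : ℝ) : EReal)) atTop ≤ ((e - c : ℝ) : EReal) := by
  obtain ⟨μ, hμ⟩ := iInf_lt_iff.1 he
  obtain ⟨C, hC⟩ := eventually_le_lintegral_weight isOpen_univ (Set.mem_univ μ) hμ
  refine limsup_log_div_le ?_ (Eventually.of_forall fun M => by positivity)
    (tendsto_exponent_div hMN hN c e C)
  filter_upwards [hC, eventually_lt_of_tendsto_div hMN hN, eventually_gt_atTop 0] with M h1 h2 h3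
  have h4 := h1 _ h2.le
  rw [Set.preimage_univ, Measure.restrict_univ] at h4
  have h5 := lintegral_weight_le h3 h2 (empiricalMeasure M ⁻¹' F) fun ζ hζ => hF _ hζ
  rw [exp_mul_pi_pow] at h5
  rw [law_apply, Real.exp_sub, ENNReal.ofReal_div_of_pos (Real.exp_pos _)]
  exact ENNReal.div_le_div h5 h4

theorem le_liminf_log_law (hMN : ∀ᶠ M : ℕ in atTop, M ≤ N M)
    (hN : Tendsto (fun M : ℕ => (M : ℝ) / (N M : ℝ)) atTop (𝓝 0))
    {O : Set (ProbabilityMeasure ℂ)} (hO : IsOpen O) {μ : ProbabilityMeasure ℂ} (hμ : μ ∈ O)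
    {e : ℝ} (he : energy μ < ENNReal.ofReal e) :
    ((minEnergy.toReal - e : ℝ) : EReal) ≤
      liminf (fun M => ENNReal.log (law M (N M) (empiricalMeasure M ⁻¹' O)) /
        (((N M : ℝ) * (M : ℝ) : ℝ) : EReal)) atTop := by
  obtain ⟨C, hC⟩ := eventually_le_lintegral_weight hO hμ he
  -- Here the lower estimate is in the numerator and the upper one, with `c` the minimal energy,
  -- bounds `normConst`; hence the sign change.
  have ht := (tendsto_exponent_div hMN hN minEnergy.toReal e C).neg
  simp_rw [← neg_div, neg_sub] at ht
  refine le_liminf_log_div ?_ (Eventually.of_forall fun M => by positivity) ht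
  filter_upwards [hC, eventually_lt_of_tendsto_div hMN hN, eventually_gt_atTop 0] with M h1 h2 h3
  have h4 := h1 _ h2.le
  have h5 := lintegral_weight_le h3 h2 (c := minEnergy.toReal) Set.univ fun ζ _ => by
    rw [ENNReal.ofReal_toReal minEnergy_ne_top]
    exact minEnergy_le _
  rw [exp_mul_pi_pow, Measure.restrict_univ] at h5
  rw [law_apply, Real.exp_sub, ENNReal.ofReal_div_of_pos (Real.exp_pos _)]
  exact ENNReal.div_le_div h4 h5

theorem satisfiesLDP_law (hMN : ∀ᶠ M : ℕ in atTop, M ≤ N M)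
    (hN : Tendsto (fun M : ℕ => (M : ℝ) / (N M : ℝ)) atTop (𝓝 0)) :
    SatisfiesLDP (fun M : ℕ => law M (N M)) (fun M : ℕ => empiricalMeasure M)
      (fun M : ℕ => (N M : ℝ) * (M : ℝ)) rateFunction where
  speed_tendsto := by
    have hNinf : Tendsto (fun M => ((N M : ℕ) : ℝ)) atTop atTop :=
      tendsto_natCast_atTop_atTop.comp (tendsto_atTop_mono' _ hMN tendsto_id)
    exact hNinf.atTop_mul_atTop₀ tendsto_natCast_atTop_atTop
  lowerSemicontinuous := lowerSemicontinuous_rateFunction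
  isCompact_sublevel := isCompact_rateFunction_le
  lower_bound O hO := by
    rw [EReal.neg_le]
    by_contra h
    obtain ⟨q, hq1, hq2⟩ := EReal.lt_iff_exists_real_btwn.1 (not_le.1 h)
    have hq0 : 0 ≤ q := by
      have : (0 : EReal) < q := (EReal.coe_ennreal_nonneg _).trans_lt hq1
      exact_mod_cast this.le
    have hq3 : (⨅ μ ∈ O, rateFunction μ) < ENNReal.ofReal q := by
      rw [← EReal.coe_ennreal_lt_coe_ennreal_iff, EReal.coe_ennreal_ofReal, max_eq_left hq0]
      exact hq1
    obtain ⟨μ, hμ, hq4⟩ := by simpa only [iInf_lt_iff, exists_prop] using hq3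
    have hq5 : energy μ < ENNReal.ofReal (q + minEnergy.toReal) := by
      rw [ENNReal.ofReal_add hq0 ENNReal.toReal_nonneg, ENNReal.ofReal_toReal minEnergy_ne_top]
      exact (ENNReal.sub_lt_iff_lt_right minEnergy_ne_top (minEnergy_le μ)).1 hq4
    have h1 := le_liminf_log_law hMN hN hO hμ hq5
    rw [show minEnergy.toReal - (q + minEnergy.toReal) = -q by ring, EReal.coe_neg,
      EReal.neg_le] at h1
    exact absurd hq2 (not_lt.2 h1)
  upper_bound F _ := by
    rw [EReal.le_neg]
    by_contra h
    obtain ⟨q, hq1, hq2⟩ := EReal.lt_iff_exists_real_btwn.1 (not_le.1 h)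
    obtain ⟨r, hr1, hr2⟩ := EReal.lt_iff_exists_real_btwn.1 hq2
    have hqr : q < r := by exact_mod_cast hr1
    -- `r` may be negative; `ENNReal.ofReal` then truncates it to `0`.
    have hr3 : ENNReal.ofReal r ≤ ⨅ μ ∈ F, rateFunction μ := by
      rw [← EReal.coe_ennreal_le_coe_ennreal_iff, EReal.coe_ennreal_ofReal,
        EReal.coe_strictMono.monotone.map_max]
      exact max_le hr2.le (EReal.coe_ennreal_nonneg _)
    have hF : ∀ μ ∈ F, ENNReal.ofReal (r + minEnergy.toReal) ≤ energy μ := fun μ hμ => by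
      refine ENNReal.ofReal_add_le.trans ?_
      rw [ENNReal.ofReal_toReal minEnergy_ne_top, ← tsub_add_cancel_of_le (minEnergy_le μ)]
      gcongr
      exact hr3.trans (iInf₂_le μ hμ)
    -- The slack `r - q` leaves room for a measure of almost minimal energy in the bound on
    -- `normConst`, and makes `e - c` exactly `-q`.
    have he : minEnergy < ENNReal.ofReal (minEnergy.toReal + (r - q)) :=
      (ENNReal.lt_ofReal_iff_toReal_lt minEnergy_ne_top).2 (by linarith)
    have h1 := limsup_log_law_le hMN hN hF he
    rw [show minEnergy.toReal + (r - q) - (r + minEnergy.toReal) = -q by ring, EReal.coe_neg,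
      EReal.le_neg] at h1
    exact absurd hq1 (not_lt.2 h1)

end Asymptotics

end ConditionedGinibre

theorem theorem3p10 (N : ℕ → ℕ) (hMN : ∀ᶠ M : ℕ in atTop, M ≤ N M)
    (hN : Tendsto (fun M : ℕ => (M : ℝ) / (N M : ℝ)) atTop (𝓝 0)) :
    (∀ M : ℕ, M ≤ N M → IsProbabilityMeasure (ConditionedGinibre.law M (N M))) ∧
    ConditionedGinibre.SatisfiesLDP
      (fun M : ℕ => ConditionedGinibre.law M (N M))
      (fun M : ℕ => ConditionedGinibre.empiricalMeasure M)
      (fun M : ℕ => (N M : ℝ) * (M : ℝ))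
      ConditionedGinibre.rateFunction :=
  ⟨fun _ h => ConditionedGinibre.isProbabilityMeasure_law h,
    ConditionedGinibre.satisfiesLDP_law hMN hN⟩
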